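/- For $N\ge 1$ let $\mathbf{SP}(N)$ be the spider with $N$ legs: the graph consisting of $N$ half-lines $\{v_N(r,j): r=0,1,2,\dots\}$, $j=1,\dots,N$ (the legs), with an edge between $v_N(r,j)$ and $v_N(r+1,j)$ for all $r,j$, glued at their common initial vertex $v_N(0)=v_N(0,1)=\dots=v_N(0,N)$ (the body). Let $(\mathbf S_n)_{n\ge 0}$ be the Markov chain on $\mathbf{SP}(N)$ with $\mathbf S_0=v_N(0)$ which steps from the body to $v_N(1,j)$ with probability $1/N$ for each $j=1,\dots,N$, and from $v_N(r,j)$, $r\ge1$, to $v_N(r+1,j)$ or $v_N(r-1,j)$ with probability $1/2$ each. Let $M(n,L)$ be the event that for every $j=1,\dots,N$ there is a $k\le n$ with $\mathbf S_k=v_N(L,j)$. **Theorem 5.2.** Let $c>0$ be a constant and let $L=L_N$ be integers with $1\le L_N\le N/\log N$ for all sufficiently large $N$ (for instance, a fixed integer $L\ge 1$). Then $$\lim_{N\to\infty}\mathbf P\Big(M\big([(cL_N N\log N)^2],\,L_N\big)\Big)=P\Big(|Z|>\frac1c\Big),$$ where $[\cdot]$ is the integer part, $\log$ is the natural logarithm,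 and $Z$ is a standard normal random variable. -/

import Mathlib

open MeasureTheory ProbabilityTheory Filter Topology

/-- Vertices of the spider with `N` legs: the body, and, for each leg `j` and each `r : ℕ`, the
vertex `leg r j` at height `r + 1` on leg `j`. -/
inductive SpiderVertex (N : ℕ) where
  | body : SpiderVertex N
  | leg (r : ℕ) (j : Fin N) : SpiderVertex N
  deriving DecidableEq

namespace SpiderVertex

/-- The vertex set is discrete: every subset is measurable. -/
instance (N : ℕ) : MeasurableSpace (SpiderVertex N) := ⊤

/-- `atHeight r j` is the vertex at height `r` on leg `j`; at height `0` it is the body, for all `j`. -/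
def atHeight {N : ℕ} : ℕ → Fin N → SpiderVertex N
  | 0, _ => body
  | r + 1, j => leg r j

end SpiderVertex

/-- One-step transition probabilities of the walk on the spider with leg probabilities `p`:
from the body to height `1` on leg `j` with probability `p j`; from height `r + 1` on leg `j`
to height `r + 2` or to height `r` on the same leg with probability `1 / 2` each. -/
noncomputable def spiderStep {N : ℕ} (p : Fin N → ℝ) : SpiderVertex N → SpiderVertex N → ℝ
  | .body, .leg 0 j => p j
  | .body, _ => 0
  | .leg r j, y =>
      if y = SpiderVertex.atHeight (r + 2) j ∨ y = SpiderVertex.atHeight r j then 1 / 2 else 0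

/-- `S` is, under `P`, a random walk on the spider with `N` legs with leg probabilities `p`:
a Markov chain started at the body with transition probabilities `spiderStep p`.
The field `markov` is the product form of
`P (S (n+1) = y | S 0 = x 0, …, S n = x n) = spiderStep p (x n) y`. -/
structure IsSpiderWalk {N : ℕ} {Ω : Type*} [MeasurableSpace Ω] (p : Fin N → ℝ) (P : Measure Ω)
    (S : ℕ → Ω → SpiderVertex N) : Prop where
  measurable : ∀ n, Measurable (S n)
  start : ∀ᵐ ω ∂P, S 0 ω = SpiderVertex.body
  markov : ∀ (n : ℕ) (x : ℕ → SpiderVertex N) (y : SpiderVertex N),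
    P.real {ω | (∀ k ≤ n, S k ω = x k) ∧ S (n + 1) ω = y} =
      P.real {ω | ∀ k ≤ n, S k ω = x k} * spiderStep p (x n) y

/-- The local time `ξ(v, n)`: the number of `k ≤ n` for which the path `s` is at `v` at time `k`. -/
def spiderLocalTime {N : ℕ} (s : ℕ → SpiderVertex N) (v : SpiderVertex N) (n : ℕ) : ℕ :=
  ((Finset.range (n + 1)).filter (fun k => s k = v)).card

/-- The event `M(n, L)`: within `n` steps the walk visits the vertex at height `L` of every leg,
that is, the minimum over the legs `j` of `ξ(v(L, j), n)` is at least `1`. -/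
def spiderAllLegsEvent {N : ℕ} {Ω : Type*} (S : ℕ → Ω → SpiderVertex N) (n L : ℕ) : Set Ω :=
  {ω | ∀ j : Fin N, 1 ≤ spiderLocalTime (fun k => S k ω) (SpiderVertex.atHeight L j) n}

/-!
Let `T` be the first time at which the vertex at height `L` has been visited on every leg. A walk
that reaches height `L` does so on a uniformly chosen leg, so the excursions that reach height `L`
collect the legs like coupons. They are traversed by independent pieces of a simple random walk,
whose hitting times have explicit generating functions. Hence, for `s = 1 / cosh θ` and
`a = L θ`, the generating function of `T` is known exactly:
`E (s ^ T) = exp a * ∏_{i=1}^N (1 + (N / i) * exp a * sinh a)⁻¹`.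

This identity is `IsSpiderWalk.integral_coverWeight_cosh`. No decomposition into excursions is
needed to prove it: the function `coverValue` of the current vertex and the set of covered legs,
which is the conditional expectation of `s` to the remaining time, can be written down, its
harmonicity (`tsum_spiderStep_mul_coverValue`) is a finite computation with the Markov property, and
optional stopping (`IsSpiderWalk.integral_coverWeight`) gives the claim.

Put `A = (c L N log N) ^ 2` and choose `θ` with `cosh θ = exp (k / A)`. Then `θ ~ √(2 k / A)`,
hence `a N log N → √(2 k) / c`, and as the harmonic numbers grow like `log N`, the product tends to
`exp (-√(2 k) / c)` (`tendsto_collectorProd`). So `E (exp (-k T / A)) → exp (-√(2 k) / c)`, which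
is `E (exp (-k / (c Z) ^ 2))` for a standard normal `Z` (`integral_exp_neg_div_sq_gaussianReal`).

For `k = 0, 1, 2, …` this says that the moments of the `[0, 1]`-valued variables `exp (-T / A)`
converge to those of `exp (-1 / (c Z) ^ 2)`. By the method of moments
(`tendsto_measureReal_le_of_moments`) the probability of `T ≤ A`, that is of
`exp (-T / A) ≥ exp (-1)`, converges to the probability of `1 / (c Z) ^ 2 ≤ 1`, that is of
`|Z| ≥ 1 / c`.
-/

/-! ### The method of moments on the unit interval -/

/-- On the unit interval convergence of all moments implies weak convergence, by the Weierstrass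
approximation theorem. -/
theorem tendsto_integral_of_moments {μ : ℕ → Measure unitInterval}
    [∀ n, IsProbabilityMeasure (μ n)] {ν : Measure unitInterval} [IsProbabilityMeasure ν]
    (h : ∀ k : ℕ, Tendsto (fun n => ∫ x, (x : ℝ) ^ k ∂μ n) atTop (𝓝 (∫ x, (x : ℝ) ^ k ∂ν)))
    (f : C(unitInterval, ℝ)) :
    Tendsto (fun n => ∫ x, f x ∂μ n) atTop (𝓝 (∫ x, f x ∂ν)) := by
  have hint : ∀ (ρ : Measure unitInterval) [IsProbabilityMeasure ρ] (g : C(unitInterval, ℝ)),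
      Integrable g ρ := fun ρ _ g =>
    g.continuous.integrable_of_hasCompactSupport (HasCompactSupport.of_compactSpace _)
  have hpoly : ∀ p : Polynomial ℝ, Tendsto (fun n => ∫ x, p.eval (x : ℝ) ∂μ n) atTop
      (𝓝 (∫ x, p.eval (x : ℝ) ∂ν)) := by
    intro p
    have hsum : ∀ (ρ : Measure unitInterval) [IsProbabilityMeasure ρ],
        ∫ x, p.eval (x : ℝ) ∂ρ
          = ∑ i ∈ Finset.range (p.natDegree + 1), p.coeff i * ∫ x, (x : ℝ) ^ i ∂ρ := by
      intro ρ _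
      simp_rw [Polynomial.eval_eq_sum_range]
      rw [integral_finsetSum]
      · simp_rw [integral_const_mul]
      · exact fun i _ => hint ρ ⟨fun x => p.coeff i * (x : ℝ) ^ i, by fun_prop⟩
    simp_rw [hsum]
    exact tendsto_finsetSum _ fun i _ => (h i).const_mul _
  rw [Metric.tendsto_atTop]
  intro ε hε
  obtain ⟨p, hp⟩ := exists_polynomial_near_continuousMap 0 1 f (ε / 3) (by positivity)
  have hclose : ∀ (ρ : Measure unitInterval) [IsProbabilityMeasure ρ],
      |∫ x, p.eval (x : ℝ) ∂ρ - ∫ x, f x ∂ρ| ≤ ε / 3 := by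
    intro ρ _
    have h1 : Integrable (fun x : unitInterval => p.eval (x : ℝ)) ρ :=
      hint ρ (p.toContinuousMapOn (Set.Icc 0 1))
    rw [← integral_sub h1 (hint ρ f)]
    have h2 : ∀ x : unitInterval, ‖p.eval (x : ℝ) - f x‖ ≤ ε / 3 := fun x =>
      ((p.toContinuousMapOn (Set.Icc 0 1) - f).norm_coe_le_norm x).trans hp.le
    simpa using norm_integral_le_of_norm_le_const (μ := ρ) (Eventually.of_forall h2)
  obtain ⟨n₀, hn₀⟩ := Metric.tendsto_atTop.1 (hpoly p) (ε / 3) (by positivity)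
  refine ⟨n₀, fun n hn => ?_⟩
  have h1 := abs_le.1 (hclose (μ n))
  have h2 := abs_le.1 (hclose ν)
  have h3 := abs_lt.1 (hn₀ n hn)
  rw [Real.dist_eq, abs_lt]
  constructor <;> linarith [h1.1, h1.2, h2.1, h2.2, h3.1, h3.2]

/-- The method of moments for `[0, 1]`-valued random variables, possibly on different probability
spaces: upper tails converge at every level that is not an atom of the limit. -/
theorem tendsto_measureReal_le_of_moments {Ω : ℕ → Type*} [∀ n, MeasurableSpace (Ω n)]
    {P : ∀ n, Measure (Ω n)} [∀ n, IsProbabilityMeasure (P n)] {X : ∀ n, Ω n → unitInterval}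
    (hX : ∀ n, Measurable (X n)) {Ω' : Type*} [MeasurableSpace Ω'] {Q : Measure Ω'}
    [IsProbabilityMeasure Q] {Y : Ω' → unitInterval} (hY : Measurable Y)
    (h : ∀ k : ℕ, Tendsto (fun n => ∫ ω, (X n ω : ℝ) ^ k ∂P n) atTop
      (𝓝 (∫ ω, (Y ω : ℝ) ^ k ∂Q)))
    (t : unitInterval) (ht : Q {ω | Y ω = t} = 0) :
    Tendsto (fun n => (P n).real {ω | t ≤ X n ω}) atTop (𝓝 (Q.real {ω | t ≤ Y ω})) := by
  have hpX : ∀ n, IsProbabilityMeasure ((P n).map (X n)) := fun n =>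
    Measure.isProbabilityMeasure_map (hX n).aemeasurable
  have hpY : IsProbabilityMeasure (Q.map Y) := Measure.isProbabilityMeasure_map hY.aemeasurable
  let μ : ℕ → ProbabilityMeasure unitInterval := fun n => ⟨(P n).map (X n), hpX n⟩
  let ν : ProbabilityMeasure unitInterval := ⟨Q.map Y, hpY⟩
  have hlim : Tendsto μ atTop (𝓝 ν) := by
    rw [ProbabilityMeasure.tendsto_iff_forall_integral_tendsto]
    intro f
    refine tendsto_integral_of_moments (μ := fun n => (P n).map (X n)) (ν := Q.map Y)
      (fun k => ?_) f.toContinuousMap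
    have hm : Continuous fun x : unitInterval => (x : ℝ) ^ k := by fun_prop
    rw [integral_map hY.aemeasurable hm.aestronglyMeasurable]
    simp_rw [fun n => integral_map (hX n).aemeasurable
      (hm.aestronglyMeasurable (μ := (P n).map (X n)))]
    exact h k
  have hfr : (ν : Measure unitInterval) (frontier (Set.Ici t)) = 0 := by
    refine measure_mono_null (t := {t}) ?_ ?_
    · exact frontier_Ici_subset t
    · change Q.map Y {t} = 0
      rwa [Measure.map_apply hY (measurableSet_singleton t)]
  have := ProbabilityMeasure.tendsto_measure_of_null_frontier_of_tendsto' hlim hfr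
  have := (ENNReal.tendsto_toReal (measure_ne_top _ _)).comp this
  change Tendsto (fun n => ((P n).map (X n) (Set.Ici t)).toReal) atTop
    (𝓝 (Q.map Y (Set.Ici t)).toReal) at this
  rw [Measure.map_apply hY measurableSet_Ici] at this
  simp_rw [fun n => Measure.map_apply (μ := P n) (hX n) (measurableSet_Ici (a := t))] at this
  exact this

/-! ### The Laplace transform of the inverse square of a standard normal variable -/

/-- With `φ` the standard normal density and `G` a primitive of `φ`, the integrand
`f z = exp (-b ^ 2 / (2 * z ^ 2)) * φ z` equals both `exp (-b) * φ (z - b / z)` and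
`exp b * φ (z + b / z)`, so that `(exp (-b) * G (z - b / z) + exp b * G (z + b / z)) / 2` is a
primitive of `f` on `(0, ∞)`. -/
theorem integral_Ioi_exp_neg_div_sq_mul_gaussianPDFReal {b : ℝ} (hb : 0 < b) :
    ∫ z in Set.Ioi 0, Real.exp (-(b ^ 2 / (2 * z ^ 2))) * gaussianPDFReal 0 1 z
      = Real.exp (-b) / 2 := by
  set φ := gaussianPDFReal 0 1 with hφ
  have hφe : ∀ z, φ z = (√(2 * Real.pi))⁻¹ * Real.exp (-z ^ 2 / 2) := by
    intro z; simp [hφ, gaussianPDFReal]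
  have hφc : Continuous φ := by
    rw [show φ = _ from funext hφe]; fun_prop
  have hφi : Integrable φ := integrable_gaussianPDFReal 0 1
  set G : ℝ → ℝ := fun u => ∫ x in (0 : ℝ)..u, φ x with hG
  have hGd : ∀ u, HasDerivAt G (φ u) u := fun u => hφc.integral_hasStrictDerivAt 0 u |>.hasDerivAt
  set A := ∫ x in Set.Ioi 0, φ x with hA
  set B := ∫ x in Set.Iic 0, φ x with hB
  have hAB : B + A = 1 := by
    rw [hA, hB, intervalIntegral.integral_Iic_add_Ioi hφi.integrableOn hφi.integrableOn]
    exact integral_gaussianPDFReal_eq_one 0 one_ne_zero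
  have hGtop : Tendsto G atTop (𝓝 A) :=
    intervalIntegral_tendsto_integral_Ioi 0 hφi.integrableOn tendsto_id
  have hGbot : Tendsto G atBot (𝓝 (-B)) := by
    have := (intervalIntegral_tendsto_integral_Iic (μ := volume) 0 hφi.integrableOn tendsto_id).neg
    refine this.congr fun u => ?_
    simp only [hG, id]
    rw [intervalIntegral.integral_symm]
    simp
  set F : ℝ → ℝ := fun z =>
    (Real.exp (-b) * G (z - b / z) + Real.exp b * G (z + b / z)) / 2 with hF
  have hkey : ∀ z, 0 < z → Real.exp (-b) * φ (z - b / z)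
      = Real.exp (-(b ^ 2 / (2 * z ^ 2))) * φ z := by
    intro z hz
    rw [hφe, hφe, mul_left_comm, mul_left_comm (Real.exp (-(b ^ 2 / (2 * z ^ 2)))),
      ← Real.exp_add, ← Real.exp_add]
    congr 2
    field_simp
    ring
  have hkey' : ∀ z, 0 < z → Real.exp b * φ (z + b / z)
      = Real.exp (-(b ^ 2 / (2 * z ^ 2))) * φ z := by
    intro z hz
    rw [hφe, hφe, mul_left_comm, mul_left_comm (Real.exp (-(b ^ 2 / (2 * z ^ 2)))),
      ← Real.exp_add, ← Real.exp_add]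
    congr 2
    field_simp
    ring
  have hFd : ∀ z ∈ Set.Ioi (0 : ℝ), HasDerivAt F
      (Real.exp (-(b ^ 2 / (2 * z ^ 2))) * φ z) z := by
    intro z hz
    have hz : 0 < z := hz
    have hd : HasDerivAt (fun z => b / z) (-(b / z ^ 2)) z := by
      have := (hasDerivAt_inv hz.ne').const_mul b
      simpa [div_eq_mul_inv] using this
    have h1 := ((hGd (z - b / z)).comp z ((hasDerivAt_id z).sub hd)).const_mul (Real.exp (-b))
    have h2 := ((hGd (z + b / z)).comp z ((hasDerivAt_id z).add hd)).const_mul (Real.exp b)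
    convert! (h1.add h2).div_const 2 using 1
    rw [← mul_assoc, ← mul_assoc, hkey z hz, hkey' z hz]
    ring
  have hinv : Tendsto (fun z : ℝ => b / z) (𝓝[>] 0) atTop := by
    simpa [div_eq_mul_inv] using tendsto_inv_nhdsGT_zero.const_mul_atTop hb
  have hid : Tendsto (fun z : ℝ => z) (𝓝[>] 0) (𝓝 0) := tendsto_id.mono_left nhdsWithin_le_nhds
  have hF0 : Tendsto F (𝓝[>] 0) (𝓝 ((Real.exp (-b) * (-B) + Real.exp b * A) / 2)) := by
    refine (((hGbot.comp ?_).const_mul _).add ((hGtop.comp ?_).const_mul _)).div_const 2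
    · simp_rw [sub_eq_add_neg]
      exact hid.add_atBot (tendsto_neg_atTop_atBot.comp hinv)
    · exact hid.add_atTop hinv
  have hinv' : Tendsto (fun z : ℝ => b / z) atTop (𝓝 0) := tendsto_const_nhds.div_atTop tendsto_id
  have hFtop : Tendsto F atTop (𝓝 ((Real.exp (-b) * A + Real.exp b * A) / 2)) := by
    refine (((hGtop.comp ?_).const_mul _).add ((hGtop.comp ?_).const_mul _)).div_const 2
    · simp_rw [sub_eq_add_neg]
      exact tendsto_id.atTop_add (by simpa using hinv'.neg)
    · exact tendsto_id.atTop_add hinv'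
  set F₀ := (Real.exp (-b) * (-B) + Real.exp b * A) / 2 with hF₀
  have := integral_Ioi_of_hasDerivAt_of_nonneg (a := 0) (g := Function.update F 0 F₀)
    (g' := fun z => Real.exp (-(b ^ 2 / (2 * z ^ 2))) * φ z)
    (l := (Real.exp (-b) * A + Real.exp b * A) / 2) ?_ ?_ ?_ ?_
  · rw [this, Function.update_self, hF₀]
    linear_combination Real.exp (-b) / 2 * hAB
  · rw [continuousWithinAt_update_same, Set.Ici_sdiff_left]
    exact hF0
  · intro z hz
    refine (hFd z hz).congr_of_eventuallyEq ?_
    filter_upwards [eventually_ne_nhds (ne_of_gt hz)] with y hy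
    exact Function.update_of_ne hy _ _
  · exact fun z _ => mul_nonneg (Real.exp_nonneg _) (gaussianPDFReal_nonneg 0 1 z)
  · refine hFtop.congr' ?_
    filter_upwards [eventually_ne_atTop 0] with y hy
    exact (Function.update_of_ne hy _ _).symm

/-- The Laplace transform of `1 / Z ^ 2` for a standard normal `Z`, at `b ^ 2 / 2`. -/
theorem integral_exp_neg_div_sq_gaussianReal {b : ℝ} (hb : 0 < b) :
    ∫ z, Real.exp (-(b ^ 2 / (2 * z ^ 2))) ∂(gaussianReal 0 1) = Real.exp (-b) := by
  rw [integral_gaussianReal_eq_integral_smul one_ne_zero]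
  have h := integral_comp_abs
    (f := fun z => Real.exp (-(b ^ 2 / (2 * z ^ 2))) * gaussianPDFReal 0 1 z)
  rw [integral_Ioi_exp_neg_div_sq_mul_gaussianPDFReal hb] at h
  rw [show Real.exp (-b) = 2 * (Real.exp (-b) / 2) by ring, ← h]
  refine integral_congr_ae (Eventually.of_forall fun z => ?_)
  simp [gaussianPDFReal, mul_comm]

/-! ### Covered legs and the cover time of a path -/

namespace SpiderVertex

variable {N : ℕ}

instance : Countable (SpiderVertex N) := by
  refine Function.Injective.countable
    (f := fun v : SpiderVertex N => (match v with
      | body => none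
      | leg r j => some (r, j) : Option (ℕ × Fin N))) ?_
  rintro (_ | ⟨r, j⟩) (_ | ⟨r', j'⟩) h <;> simp_all

/-- The set of legs `j` whose vertex at height `L` is `v`. -/
def cover (L : ℕ) (v : SpiderVertex N) : Finset (Fin N) :=
  Finset.univ.filter fun j => v = atHeight L j

theorem cover_atHeight {L : ℕ} (hL : 1 ≤ L) (h : ℕ) (j : Fin N) :
    cover L (atHeight h j) = if h = L then {j} else ∅ := by
  obtain ⟨l, rfl⟩ : ∃ l, L = l + 1 := ⟨L - 1, by omega⟩
  ext i
  rcases h with _ | h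
  · simp [cover, atHeight]
  · by_cases hh : h = l
    · simp [cover, atHeight, hh, eq_comm]
    · simp [cover, atHeight, hh]

/-- The set of legs whose vertex at height `L` is visited by the path `x` up to time `n`. -/
def coveredLegs (L : ℕ) (x : ℕ → SpiderVertex N) (n : ℕ) : Finset (Fin N) :=
  (Finset.range (n + 1)).biUnion fun k => cover L (x k)

theorem coveredLegs_zero (L : ℕ) (x : ℕ → SpiderVertex N) :
    coveredLegs L x 0 = cover L (x 0) := by
  simp [coveredLegs]

theorem coveredLegs_succ (L : ℕ) (x : ℕ → SpiderVertex N) (n : ℕ) :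
    coveredLegs L x (n + 1) = coveredLegs L x n ∪ cover L (x (n + 1)) := by
  simp [coveredLegs, Finset.range_add_one (n := n + 1), Finset.biUnion_insert, Finset.union_comm]

theorem cover_subset_coveredLegs (L : ℕ) (x : ℕ → SpiderVertex N) (n : ℕ) :
    cover L (x n) ⊆ coveredLegs L x n :=
  Finset.subset_biUnion_of_mem (fun k => cover L (x k)) (Finset.self_mem_range_succ n)

theorem coveredLegs_mono (L : ℕ) (x : ℕ → SpiderVertex N) : Monotone (coveredLegs L x) :=
  fun _ _ h => Finset.biUnion_subset_biUnion_of_subset_left _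
    (Finset.range_subset_range.2 (by omega))

theorem coveredLegs_congr (L : ℕ) {x y : ℕ → SpiderVertex N} {n : ℕ}
    (h : ∀ k ≤ n, x k = y k) {m : ℕ} (hm : m ≤ n) : coveredLegs L x m = coveredLegs L y m := by
  refine Finset.biUnion_congr rfl fun k hk => ?_
  rw [h k (by have := Finset.mem_range.1 hk; omega)]

/-- The first time by which the path `x` has visited height `L` on every leg
(`0` if there is none). -/
noncomputable def coverTime (L : ℕ) (x : ℕ → SpiderVertex N) : ℕ :=
  sInf {n | coveredLegs L x n = Finset.univ}

theorem coveredLegs_eq_univ_iff {L : ℕ} {x : ℕ → SpiderVertex N}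
    (h : ∃ n, coveredLegs L x n = Finset.univ) (n : ℕ) :
    coveredLegs L x n = Finset.univ ↔ coverTime L x ≤ n := by
  refine ⟨fun hn => Nat.sInf_le hn, fun hn => ?_⟩
  have h1 : coveredLegs L x (coverTime L x) = Finset.univ := Nat.sInf_mem h
  exact Finset.univ_subset_iff.1 (h1 ▸ coveredLegs_mono L x hn)

theorem coverTime_congr {L : ℕ} {x y : ℕ → SpiderVertex N} {n : ℕ} (h : ∀ k ≤ n, x k = y k)
    (hx : coveredLegs L x n = Finset.univ) : coverTime L x = coverTime L y := by
  have hy : coveredLegs L y n = Finset.univ := by rw [← hx, coveredLegs_congr L h le_rfl]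
  have hxn := (coveredLegs_eq_univ_iff ⟨n, hx⟩ n).1 hx
  have hyn := (coveredLegs_eq_univ_iff ⟨n, hy⟩ n).1 hy
  refine le_antisymm ?_ ?_
  · rw [← coveredLegs_eq_univ_iff ⟨n, hx⟩, coveredLegs_congr L h hyn]
    exact (coveredLegs_eq_univ_iff ⟨n, hy⟩ _).2 le_rfl
  · rw [← coveredLegs_eq_univ_iff ⟨n, hy⟩, ← coveredLegs_congr L h hxn]
    exact (coveredLegs_eq_univ_iff ⟨n, hx⟩ _).2 le_rfl

/-- `s ^ T`, where `T` is the cover time of the path `x`, read as `0` if `T` is infinite. -/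
noncomputable def coverWeight (L : ℕ) (s : ℝ) (x : ℕ → SpiderVertex N) : ℝ :=
  open Classical in
  if ∃ n, coveredLegs L x n = Finset.univ then s ^ coverTime L x else 0

/-- The process `s ^ n * F (x n) (coveredLegs L x n)`, replaced from the cover time `T` on by the
constant `s ^ T`. -/
noncomputable def stoppedWeight (L : ℕ) (s : ℝ) (F : SpiderVertex N → Finset (Fin N) → ℝ) (n : ℕ)
    (x : ℕ → SpiderVertex N) : ℝ :=
  if coveredLegs L x n = Finset.univ then s ^ coverTime L x else s ^ n * F (x n) (coveredLegs L x n)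

theorem stoppedWeight_congr (L : ℕ) (s : ℝ) (F : SpiderVertex N → Finset (Fin N) → ℝ) (n : ℕ)
    {x y : ℕ → SpiderVertex N} (h : ∀ k ≤ n, x k = y k) :
    stoppedWeight L s F n x = stoppedWeight L s F n y := by
  have h1 := coveredLegs_congr L h le_rfl
  unfold stoppedWeight
  by_cases hx : coveredLegs L x n = Finset.univ
  · rw [if_pos hx, if_pos (h1 ▸ hx), coverTime_congr h hx]
  · rw [if_neg hx, if_neg (h1 ▸ hx), h1, h n le_rfl]

theorem abs_stoppedWeight_le (L : ℕ) {s : ℝ} (hs0 : 0 ≤ s) (hs1 : s ≤ 1)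
    {F : SpiderVertex N → Finset (Fin N) → ℝ} {C : ℝ} (hC : 1 ≤ C) (hF : ∀ v A, |F v A| ≤ C)
    (n : ℕ) (x : ℕ → SpiderVertex N) : |stoppedWeight L s F n x| ≤ C := by
  unfold stoppedWeight
  split_ifs
  · rw [abs_of_nonneg (by positivity)]
    exact (pow_le_one₀ hs0 hs1).trans hC
  · rw [abs_mul, abs_of_nonneg (by positivity)]
    exact (mul_le_of_le_one_left (abs_nonneg _) (pow_le_one₀ hs0 hs1)).trans (hF _ _)

theorem tendsto_stoppedWeight (L : ℕ) {s : ℝ} (hs0 : 0 ≤ s) (hs1 : s < 1)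
    {F : SpiderVertex N → Finset (Fin N) → ℝ} {C : ℝ} (hF : ∀ v A, |F v A| ≤ C)
    (x : ℕ → SpiderVertex N) :
    Tendsto (fun n => stoppedWeight L s F n x) atTop (𝓝 (coverWeight L s x)) := by
  unfold coverWeight
  split_ifs with h
  · refine tendsto_const_nhds.congr' ?_
    filter_upwards [eventually_ge_atTop (coverTime L x)] with n hn
    rw [stoppedWeight, if_pos ((coveredLegs_eq_univ_iff h n).2 hn)]
  · push Not at h
    have h1 : Tendsto (fun n : ℕ => s ^ n * C) atTop (𝓝 0) := by
      simpa using (tendsto_pow_atTop_nhds_zero_of_lt_one hs0 hs1).mul_const C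
    refine squeeze_zero_norm (fun n => ?_) h1
    rw [stoppedWeight, if_neg (h n), Real.norm_eq_abs, abs_mul, abs_of_nonneg (by positivity)]
    exact mul_le_mul_of_nonneg_left (hF _ _) (by positivity)

/-- Since `F = 1` at the moment of covering, up to and including the cover time the stopped process
is given by the formula for the unstopped one. -/
theorem stoppedWeight_succ {L : ℕ} {s : ℝ} {F : SpiderVertex N → Finset (Fin N) → ℝ}
    (hF : ∀ v, (cover L v).Nonempty → F v Finset.univ = 1) {n : ℕ} {x : ℕ → SpiderVertex N}
    (hx : coveredLegs L x n ≠ Finset.univ) :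
    stoppedWeight L s F (n + 1) x
      = s ^ (n + 1) * F (x (n + 1)) (coveredLegs L x n ∪ cover L (x (n + 1))) := by
  rw [← coveredLegs_succ, stoppedWeight]
  split_ifs with h
  · have h1 : coverTime L x = n + 1 := by
      refine le_antisymm ((coveredLegs_eq_univ_iff ⟨_, h⟩ _).1 h) ?_
      by_contra! hlt
      exact hx ((coveredLegs_eq_univ_iff ⟨_, h⟩ _).2 (by omega))
    rw [h1, h, hF, mul_one]
    rw [Finset.nonempty_iff_ne_empty]
    intro h0
    rw [coveredLegs_succ, h0, Finset.union_empty] at h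
    exact hx h
  · rfl

end SpiderVertex

open SpiderVertex

/-! ### The walk stopped at the cover time -/

theorem spiderAllLegsEvent_eq {N : ℕ} {Ω : Type*} [MeasurableSpace Ω]
    (S : ℕ → Ω → SpiderVertex N) (n L : ℕ) :
    spiderAllLegsEvent S n L = {ω | coveredLegs L (fun k => S k ω) n = Finset.univ} := by
  ext ω
  simp only [spiderAllLegsEvent, spiderLocalTime, Set.mem_ofPred_eq, Finset.one_le_card,
    Finset.eq_univ_iff_forall]
  refine forall_congr' fun j => ?_
  simp [Finset.Nonempty, coveredLegs, cover]

theorem tsum_spiderStep_body_mul {N : ℕ} (p : Fin N → ℝ) (f : SpiderVertex N → ℝ) :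
    ∑' y, spiderStep p body y * f y = ∑ j, p j * f (leg 0 j) := by
  rw [tsum_eq_sum (s := Finset.univ.image (leg 0))]
  · rw [Finset.sum_image (fun i _ j _ h => by simpa using h)]
    rfl
  · rintro (_ | ⟨_ | r, j⟩) hy
    · simp [spiderStep]
    · simp at hy
    · simp [spiderStep]

theorem tsum_spiderStep_leg_mul {N : ℕ} (p : Fin N → ℝ) (r : ℕ) (j : Fin N)
    (f : SpiderVertex N → ℝ) :
    ∑' y, spiderStep p (leg r j) y * f y = (f (atHeight (r + 2) j) + f (atHeight r j)) / 2 := by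
  have hne : atHeight (r + 2) j ≠ atHeight r j := by
    rcases r with _ | r <;> simp [atHeight]
  rw [tsum_eq_sum (s := {atHeight (r + 2) j, atHeight r j})]
  · rw [Finset.sum_pair hne]
    simp [spiderStep]
    ring
  · intro y hy
    simp only [Finset.mem_insert, Finset.mem_singleton] at hy
    simp [spiderStep, hy]

namespace IsSpiderWalk

variable {N : ℕ} {Ω : Type*} [MeasurableSpace Ω] {p : Fin N → ℝ} {P : Measure Ω}
  {S : ℕ → Ω → SpiderVertex N}

theorem measurableSet_prefix (hS : IsSpiderWalk p P S) (n : ℕ) (x : ℕ → SpiderVertex N) :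
    MeasurableSet {ω | ∀ k ≤ n, S k ω = x k} := by
  have : {ω | ∀ k ≤ n, S k ω = x k} = ⋂ k, ⋂ (_ : k ≤ n), S k ⁻¹' {x k} := by
    ext ω; simp
  rw [this]
  exact MeasurableSet.iInter fun k => MeasurableSet.iInter fun _ =>
    hS.measurable k (MeasurableSpace.measurableSet_top)

/-- The one-step Markov property, conditionally on the path up to time `n`. -/
theorem setIntegral_next [IsProbabilityMeasure P] (hS : IsSpiderWalk p P S) (n : ℕ)
    (x : ℕ → SpiderVertex N) {f : SpiderVertex N → ℝ} {C : ℝ} (hf : ∀ y, |f y| ≤ C) :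
    ∫ ω in {ω | ∀ k ≤ n, S k ω = x k}, f (S (n + 1) ω) ∂P
      = P.real {ω | ∀ k ≤ n, S k ω = x k} * ∑' y, spiderStep p (x n) y * f y := by
  set B := {ω | ∀ k ≤ n, S k ω = x k} with hB
  have hm := hS.measurable (n + 1)
  have hf_meas : Measurable f := measurable_from_top
  have hfin : IsFiniteMeasure ((P.restrict B).map (S (n + 1))) := inferInstance
  have hsing : MeasurableSingletonClass (SpiderVertex N) :=
    ⟨fun _ => MeasurableSpace.measurableSet_top⟩
  rw [← integral_map hm.aemeasurable hf_meas.aestronglyMeasurable,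
    integral_countable (Integrable.of_bound hf_meas.aestronglyMeasurable C
      (Eventually.of_forall hf)), ← tsum_mul_left]
  refine tsum_congr fun y => ?_
  rw [smul_eq_mul, ← mul_assoc, ← hS.markov n x y, map_measureReal_apply hm
    (measurableSet_singleton y), measureReal_restrict_apply (hm (measurableSet_singleton y))]
  congr 2
  ext ω
  simp [hB, and_comm]

/-- A function of the path that depends only on its first `n + 1` vertices is measurable. -/
theorem measurable_comp_path (hS : IsSpiderWalk p P S) (n : ℕ) {f : (ℕ → SpiderVertex N) → ℝ}
    (hf : ∀ x y, (∀ k ≤ n, x k = y k) → f x = f y) :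
    Measurable fun ω => f fun k => S k ω := by
  have hsing : MeasurableSingletonClass (SpiderVertex N) :=
    ⟨fun _ => MeasurableSpace.measurableSet_top⟩
  let g : (Fin (n + 1) → SpiderVertex N) → ℝ := fun w =>
    f fun k => if h : k < n + 1 then w ⟨k, h⟩ else body
  have h1 : Measurable fun ω => fun i : Fin (n + 1) => S i ω :=
    measurable_pi_lambda _ fun i => hS.measurable i
  have h2 : Measurable g := measurable_of_countable g
  convert! h2.comp h1 using 1
  ext ω
  refine hf _ _ fun k hk => ?_
  simp [show k < n + 1 by omega]

/-- The paths up to time `n` are countably many, so an integral can be compared path by path. -/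
theorem integral_eq_of_forall_prefix (hS : IsSpiderWalk p P S) (n : ℕ) {Y Z : Ω → ℝ}
    (hY : Integrable Y P) (hZ : Integrable Z P)
    (h : ∀ x : ℕ → SpiderVertex N, ∫ ω in {ω | ∀ k ≤ n, S k ω = x k}, Y ω ∂P
      = ∫ ω in {ω | ∀ k ≤ n, S k ω = x k}, Z ω ∂P) :
    ∫ ω, Y ω ∂P = ∫ ω, Z ω ∂P := by
  let e : (Fin (n + 1) → SpiderVertex N) → ℕ → SpiderVertex N := fun w k =>
    if h : k < n + 1 then w ⟨k, h⟩ else body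
  let B : (Fin (n + 1) → SpiderVertex N) → Set Ω := fun w => {ω | ∀ k ≤ n, S k ω = e w k}
  have hBm : ∀ w, MeasurableSet (B w) := fun w => hS.measurableSet_prefix n _
  have hBd : Pairwise (Function.onFun Disjoint B) := by
    intro w w' hne
    refine Set.disjoint_left.2 fun ω h1 h2 => hne ?_
    ext i
    have := (h1 i (Nat.lt_succ_iff.1 i.2)).symm.trans (h2 i (Nat.lt_succ_iff.1 i.2))
    simpa only [e, i.2, dif_pos] using this
  have hBu : ⋃ w, B w = Set.univ := by
    refine Set.eq_univ_of_forall fun ω => Set.mem_iUnion.2 ⟨fun i => S i ω, fun k hk => ?_⟩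
    simp only [e, dif_pos (Nat.lt_succ_iff.2 hk)]
  have h1 := hasSum_integral_iUnion hBm hBd (f := Y) (μ := P) hY.integrableOn
  have h2 := hasSum_integral_iUnion hBm hBd (f := Z) (μ := P) hZ.integrableOn
  rw [hBu, setIntegral_univ] at h1 h2
  have h3 : (fun w => ∫ ω in B w, Y ω ∂P) = fun w => ∫ ω in B w, Z ω ∂P := funext fun w => h _
  rw [h3] at h1
  exact h1.unique h2

/-- Let `F` be a bounded function of the current vertex and the set of covered legs which is
harmonic for the walk killed with probability `1 - s` at each step, with boundary value `1` once
all legs are covered. Then `F`, at the start of the walk, is `E (s ^ T)` for the cover time `T`: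
the stopped process is a bounded martingale that converges to `s ^ T`. -/
theorem integral_coverWeight [IsProbabilityMeasure P] (hS : IsSpiderWalk p P S) {L : ℕ}
    {s : ℝ} (hs0 : 0 < s) (hs1 : s < 1) {F : SpiderVertex N → Finset (Fin N) → ℝ} {C : ℝ}
    (hC : 1 ≤ C) (hFC : ∀ v A, |F v A| ≤ C)
    (hF1 : ∀ v, (cover L v).Nonempty → F v Finset.univ = 1)
    (hF : ∀ v A, A ≠ Finset.univ → cover L v ⊆ A →
      s * ∑' y, spiderStep p v y * F y (A ∪ cover L y) = F v A)
    (h0 : cover L (body : SpiderVertex N) ≠ Finset.univ) :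
    Measurable (fun ω => coverWeight L s fun k => S k ω) ∧
    ∫ ω, coverWeight L s (fun k => S k ω) ∂P = F body (cover L body) := by
  let W : ℕ → Ω → ℝ := fun n ω => stoppedWeight L s F n fun k => S k ω
  have hWm : ∀ n, Measurable (W n) := fun n =>
    hS.measurable_comp_path n fun x y h => stoppedWeight_congr L s F n h
  have hWb : ∀ n ω, ‖W n ω‖ ≤ C := fun n ω => abs_stoppedWeight_le L hs0.le hs1.le hC hFC n _
  have hWi : ∀ n, Integrable (W n) P := fun n =>
    Integrable.of_bound (hWm n).aestronglyMeasurable C (Eventually.of_forall (hWb n))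
  have hlim : ∀ ω, Tendsto (fun n => W n ω) atTop (𝓝 (coverWeight L s fun k => S k ω)) :=
    fun ω => tendsto_stoppedWeight L hs0.le hs1 hFC _
  have hstep : ∀ n, ∫ ω, W (n + 1) ω ∂P = ∫ ω, W n ω ∂P := by
    intro n
    refine hS.integral_eq_of_forall_prefix n (hWi _) (hWi _) fun x => ?_
    have hB := hS.measurableSet_prefix n x
    by_cases hx : coveredLegs L x n = Finset.univ
    · refine setIntegral_congr_fun hB fun ω hω => ?_
      have h1 : coveredLegs L (fun k => S k ω) n = Finset.univ := by
        rw [← hx]; exact coveredLegs_congr L hω le_rfl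
      have h2 : coveredLegs L (fun k => S k ω) (n + 1) = Finset.univ :=
        (coveredLegs_eq_univ_iff ⟨n, h1⟩ _).2
          (((coveredLegs_eq_univ_iff ⟨n, h1⟩ _).1 h1).trans n.le_succ)
      simp only [W, stoppedWeight]
      rw [if_pos h1, if_pos h2]
    · have h1 : ∫ ω in {ω | ∀ k ≤ n, S k ω = x k}, W (n + 1) ω ∂P
          = ∫ ω in {ω | ∀ k ≤ n, S k ω = x k}, (fun y => s ^ (n + 1) *
              F y (coveredLegs L x n ∪ cover L y)) (S (n + 1) ω) ∂P := by
        refine setIntegral_congr_fun hB fun ω hω => ?_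
        have h2 : coveredLegs L (fun k => S k ω) n = coveredLegs L x n :=
          coveredLegs_congr L hω le_rfl
        simp only [W]
        rw [stoppedWeight_succ hF1 (by rwa [h2]), h2]
      have h3 : ∫ ω in {ω | ∀ k ≤ n, S k ω = x k}, W n ω ∂P
          = ∫ ω in {ω | ∀ k ≤ n, S k ω = x k}, s ^ n * F (x n) (coveredLegs L x n) ∂P := by
        refine setIntegral_congr_fun hB fun ω hω => ?_
        simp only [W]
        rw [stoppedWeight_congr L s F n hω, stoppedWeight, if_neg hx]
      rw [h1, h3, hS.setIntegral_next n x (C := C) (f := fun y => s ^ (n + 1) *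
          F y (coveredLegs L x n ∪ cover L y)), setIntegral_const, smul_eq_mul,
        ← hF (x n) _ hx (cover_subset_coveredLegs L x n)]
      · congr 1
        -- Move `s ^ (n + 1)` out of the sum and split off the factor `s` of the harmonicity of `F`.
        simp_rw [mul_left_comm _ (s ^ (n + 1))]
        rw [tsum_mul_left, pow_succ, mul_assoc]
      · intro y
        rw [abs_mul, abs_of_nonneg (by positivity)]
        exact (mul_le_of_le_one_left (abs_nonneg _) (pow_le_one₀ hs0.le hs1.le)).trans (hFC _ _)
  have hconst : ∀ n, ∫ ω, W n ω ∂P = F body (cover L body) := by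
    intro n
    induction n with
    | zero =>
      have : W 0 =ᵐ[P] fun _ => F body (cover L body) := by
        filter_upwards [hS.start] with ω hω
        simp only [W]
        rw [stoppedWeight, coveredLegs_zero, hω, if_neg h0, pow_zero, one_mul]
      rw [integral_congr_ae this]
      simp
    | succ n ih => rw [hstep, ih]
  refine ⟨measurable_of_tendsto_metrizable hWm (tendsto_pi_nhds.2 hlim), ?_⟩
  have h1 := tendsto_integral_of_dominated_convergence (μ := P) (fun _ => C)
    (fun n => (hWm n).aestronglyMeasurable) (integrable_const C)
    (fun n => Eventually.of_forall (hWb n)) (Eventually.of_forall hlim)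
  simp_rw [hconst] at h1
  exact tendsto_nhds_unique h1 tendsto_const_nhds

end IsSpiderWalk

/-! ### The value function and the generating function of the cover time -/

/-- The product `∏_{i=1}^m (1 + N y / i)⁻¹`. The waiting time of a coupon collector who still misses
`m` of `N` coupons is a sum of independent geometric variables with parameters `i / N`, and its
generating function at `1 / (1 + y)` is this product. -/
noncomputable def collectorProd (N : ℕ) (y : ℝ) (m : ℕ) : ℝ :=
  ∏ i ∈ Finset.range m, (1 + N / (i + 1) * y)⁻¹

/-- The recursion in the number of missing coupons; it balances the value function at the body. -/
theorem collectorProd_succ_mul {N : ℕ} {y : ℝ} (hy : 0 ≤ y) (m : ℕ) :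
    collectorProd N y (m + 1) * ((m + 1 : ℕ) + N * y) = (m + 1 : ℕ) * collectorProd N y m := by
  have h : (1 : ℝ) + N / (m + 1) * y ≠ 0 := by positivity
  have h' : (m : ℝ) + 1 + N * y ≠ 0 := by positivity
  rw [collectorProd, collectorProd, Finset.prod_range_succ]
  push_cast
  rw [mul_comm ((m : ℝ) + 1), mul_assoc]
  congr 1
  field_simp

theorem collectorProd_nonneg {N : ℕ} {y : ℝ} (hy : 0 ≤ y) (m : ℕ) : 0 ≤ collectorProd N y m :=
  Finset.prod_nonneg fun i _ => by positivity

theorem collectorProd_le_one {N : ℕ} {y : ℝ} (hy : 0 ≤ y) (m : ℕ) : collectorProd N y m ≤ 1 :=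
  Finset.prod_le_one (fun i _ => by positivity) fun i _ => inv_le_one_of_one_le₀ (by
    have : 0 ≤ (N : ℝ) / (i + 1) * y := by positivity
    linarith)

/-- The value function: `E (s ^ T)` with `s = 1 / cosh θ`, where `T` is the remaining time until all
legs are covered, for the walk now at `v` with the legs in `A` already covered.
On a covered leg the walk must return to the body, which from height `h` costs the factor
`exp (-h * θ)`. On an uncovered leg below height `L` it leaves the interval `(0, L)` at either end,
with the corresponding factors `sinh ((L - h) * θ) / sinh (L * θ)` and
`sinh (h * θ) / sinh (L * θ)`. Above height `L` on an uncovered leg, where the walk cannot be when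
started at the body, the value is the one that keeps the function harmonic. -/
noncomputable def coverValue (L : ℕ) (θ : ℝ) {N : ℕ} (v : SpiderVertex N)
    (A : Finset (Fin N)) : ℝ :=
  let a := L * θ
  let H := collectorProd N (Real.exp a * Real.sinh a)
  let m := Aᶜ.card
  match v with
  | body => Real.exp a * H m
  | leg r j =>
    if j ∈ A then Real.exp (a - (r + 1 : ℕ) * θ) * H m
    else if r + 1 ≤ L then
      (Real.sinh (a - (r + 1 : ℕ) * θ) * Real.exp a * H m
        + Real.sinh ((r + 1 : ℕ) * θ) * H (m - 1)) / Real.sinh a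
    else Real.exp (a - (r + 1 : ℕ) * θ) * H (m - 1)

section

variable {N L : ℕ} {θ : ℝ}

/-- Values after the leg has been marked as covered in case the vertex is at height `L`. The formulas
of this lemma and the next two hold at both ends of their ranges of heights, in particular at the
body (`h = 0`), so that harmonicity needs no separate treatment of neighbours of `0` and `L`. -/
theorem coverValue_of_mem (hL : 1 ≤ L) (h : ℕ) {j : Fin N} {A : Finset (Fin N)} (hj : j ∈ A) :
    coverValue L θ (atHeight h j) (A ∪ cover L (atHeight h j))
      = Real.exp (L * θ - h * θ)
        * collectorProd N (Real.exp (L * θ) * Real.sinh (L * θ)) Aᶜ.card := by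
  have h1 : A ∪ cover L (atHeight h j) = A := by
    rw [cover_atHeight hL]
    split_ifs <;> simp [hj]
  rw [h1]
  rcases h with _ | h
  · simp [coverValue, atHeight]
  · simp [coverValue, atHeight, hj]

theorem coverValue_of_le_height (hL : 1 ≤ L) {h : ℕ} (hh : L ≤ h) {j : Fin N}
    {A : Finset (Fin N)} (hj : j ∉ A) :
    coverValue L θ (atHeight h j) (A ∪ cover L (atHeight h j))
      = Real.exp (L * θ - h * θ)
        * collectorProd N (Real.exp (L * θ) * Real.sinh (L * θ)) (Aᶜ.card - 1) := by
  rw [cover_atHeight hL]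
  obtain ⟨r, rfl⟩ : ∃ r, h = r + 1 := ⟨h - 1, by omega⟩
  split_ifs with hr
  · have hc : (Aᶜ.erase j).card = Aᶜ.card - 1 := Finset.card_erase_of_mem (by simpa using hj)
    simp [coverValue, atHeight, hc]
  · simp [coverValue, atHeight, hj, show ¬ r + 1 ≤ L by omega]

theorem coverValue_of_height_le (hθ : 0 < θ) (hL : 1 ≤ L) {h : ℕ} (hh : h ≤ L) {j : Fin N}
    {A : Finset (Fin N)} (hj : j ∉ A) :
    coverValue L θ (atHeight h j) (A ∪ cover L (atHeight h j))
      = (Real.sinh (L * θ - h * θ) * Real.exp (L * θ)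
          * collectorProd N (Real.exp (L * θ) * Real.sinh (L * θ)) Aᶜ.card
        + Real.sinh (h * θ)
          * collectorProd N (Real.exp (L * θ) * Real.sinh (L * θ)) (Aᶜ.card - 1))
        / Real.sinh (L * θ) := by
  have hL0 : (0 : ℝ) < L := by exact_mod_cast hL
  have hsinh : Real.sinh (L * θ) ≠ 0 := (Real.sinh_pos_iff.2 (by positivity)).ne'
  rcases hh.eq_or_lt with rfl | hlt
  · rw [coverValue_of_le_height hL le_rfl hj]
    simp [hsinh]
  · rw [cover_atHeight hL, if_neg hlt.ne, Finset.union_empty]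
    rcases h with _ | r
    · simp [coverValue, atHeight]
      field_simp
    · simp [coverValue, atHeight, hj, hh]

theorem coverValue_univ (hL : 1 ≤ L) {v : SpiderVertex N} (hv : (cover L v).Nonempty) :
    coverValue L θ v Finset.univ = 1 := by
  obtain ⟨j, hj⟩ := hv
  obtain rfl : v = atHeight L j := by simpa [cover] using hj
  have := coverValue_of_mem (θ := θ) hL L (Finset.mem_univ j)
  rw [Finset.union_eq_left.2 (Finset.subset_univ _)] at this
  simpa [collectorProd] using this

theorem coverValue_body_empty :
    coverValue L θ (body : SpiderVertex N) ∅ = Real.exp (L * θ)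
      * collectorProd N (Real.exp (L * θ) * Real.sinh (L * θ)) N := by
  simp [coverValue]

theorem abs_coverValue_le (hθ : 0 < θ) (hL : 1 ≤ L) (v : SpiderVertex N) (A : Finset (Fin N)) :
    |coverValue L θ v A| ≤ Real.exp (L * θ) + 1 := by
  have hL0 : (0 : ℝ) < L := by exact_mod_cast hL
  have ha : 0 < L * θ := by positivity
  have hsinh : 0 < Real.sinh (L * θ) := Real.sinh_pos_iff.2 ha
  have hy : 0 ≤ Real.exp (L * θ) * Real.sinh (L * θ) := by positivity
  have hH0 := fun m => collectorProd_nonneg (N := N) hy m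
  have hH1 := fun m => collectorProd_le_one (N := N) hy m
  have hexp : ∀ (h m : ℕ), |Real.exp (L * θ - h * θ)
      * collectorProd N (Real.exp (L * θ) * Real.sinh (L * θ)) m| ≤ Real.exp (L * θ) + 1 := by
    intro h m
    rw [abs_of_nonneg (mul_nonneg (Real.exp_nonneg _) (hH0 m))]
    have h1 : Real.exp (L * θ - h * θ) ≤ Real.exp (L * θ) :=
      Real.exp_le_exp.2 (by have : 0 ≤ h * θ := by positivity
                            linarith)
    have h2 := mul_le_of_le_one_right (Real.exp_nonneg (L * θ - h * θ)) (hH1 m)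
    linarith
  rcases v with _ | ⟨r, j⟩
  · simpa [coverValue] using hexp 0 Aᶜ.card
  · simp only [coverValue]
    split_ifs with h1 h2
    · exact hexp _ _
    · have hr : ((r + 1 : ℕ) : ℝ) * θ ≤ L * θ :=
        mul_le_mul_of_nonneg_right (by exact_mod_cast h2) hθ.le
      have hr0 : 0 ≤ ((r + 1 : ℕ) : ℝ) * θ := by positivity
      have hs1 : 0 ≤ Real.sinh (L * θ - (r + 1 : ℕ) * θ) := Real.sinh_nonneg_iff.2 (by linarith)
      have hs2 : 0 ≤ Real.sinh ((r + 1 : ℕ) * θ) := Real.sinh_nonneg_iff.2 hr0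
      have hs3 : Real.sinh (L * θ - (r + 1 : ℕ) * θ) ≤ Real.sinh (L * θ) :=
        Real.sinh_le_sinh.2 (by linarith)
      have hs4 : Real.sinh ((r + 1 : ℕ) * θ) ≤ Real.sinh (L * θ) := Real.sinh_le_sinh.2 hr
      rw [abs_of_nonneg (div_nonneg (add_nonneg (mul_nonneg (mul_nonneg hs1 (Real.exp_nonneg _))
        (hH0 _)) (mul_nonneg hs2 (hH0 _))) hsinh.le), div_le_iff₀ hsinh]
      have h3 := mul_le_of_le_one_right (mul_nonneg hs1 (Real.exp_nonneg (L * θ))) (hH1 Aᶜ.card)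
      have h4 := mul_le_of_le_one_right hs2 (hH1 (Aᶜ.card - 1))
      have h5 := mul_le_mul_of_nonneg_right hs3 (Real.exp_nonneg (L * θ))
      linarith
    · exact hexp _ _

/-- The value function is harmonic for the killed walk. On the legs this is the addition theorem for
`exp` and `sinh`, at the body it is the recursion of `collectorProd`. -/
theorem tsum_spiderStep_mul_coverValue (hN : 1 ≤ N) (hθ : 0 < θ) (hL : 1 ≤ L)
    (v : SpiderVertex N) {A : Finset (Fin N)} (hA : A ≠ Finset.univ) (hv : cover L v ⊆ A) :
    ∑' y, spiderStep (fun _ : Fin N => 1 / (N : ℝ)) v y * coverValue L θ y (A ∪ cover L y)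
      = Real.cosh θ * coverValue L θ v A := by
  have hL0 : (0 : ℝ) < L := by exact_mod_cast hL
  have hN0 : (0 : ℝ) < N := by exact_mod_cast hN
  have hsinh : 0 < Real.sinh (L * θ) := Real.sinh_pos_iff.2 (by positivity)
  have hy : 0 ≤ Real.exp (L * θ) * Real.sinh (L * θ) := by positivity
  have hexp : ∀ b : ℝ, Real.exp (b - θ) = Real.exp b * (Real.cosh θ - Real.sinh θ) := fun b => by
    rw [Real.cosh_sub_sinh, sub_eq_add_neg, Real.exp_add]
  have hexp' : ∀ b : ℝ, Real.exp (b + θ) = Real.exp b * (Real.cosh θ + Real.sinh θ) := fun b => by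
    rw [Real.cosh_add_sinh, Real.exp_add]
  rcases v with _ | ⟨r, j⟩
  · rw [tsum_spiderStep_body_mul]
    have hj : ∀ j : Fin N, coverValue L θ (leg 0 j) (A ∪ cover L (leg 0 j)) = if j ∈ A then
        Real.exp (L * θ - θ) * collectorProd N (Real.exp (L * θ) * Real.sinh (L * θ)) Aᶜ.card
        else (Real.sinh (L * θ - θ) * Real.exp (L * θ)
          * collectorProd N (Real.exp (L * θ) * Real.sinh (L * θ)) Aᶜ.card
        + Real.sinh θ
          * collectorProd N (Real.exp (L * θ) * Real.sinh (L * θ)) (Aᶜ.card - 1))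
        / Real.sinh (L * θ) := by
      intro j
      split_ifs with h
      · simpa [atHeight] using coverValue_of_mem (θ := θ) hL 1 h
      · simpa [atHeight] using coverValue_of_height_le hθ hL hL h
    have hbody : coverValue L θ (body : SpiderVertex N) A = Real.exp (L * θ)
        * collectorProd N (Real.exp (L * θ) * Real.sinh (L * θ)) Aᶜ.card := rfl
    simp_rw [hj, hbody]
    rw [← Finset.mul_sum, Finset.sum_ite, Finset.sum_const, Finset.sum_const]
    have hc1 : (Finset.univ.filter fun j => j ∉ A).card = Aᶜ.card := by
      congr 1; ext; simp
    have hc2 : ((Finset.univ.filter fun j => j ∈ A).card : ℝ) = N - Aᶜ.card := by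
      have h1 : (Finset.univ.filter fun j => j ∈ A) = A := by ext; simp
      have h2 := Finset.card_add_card_compl A
      rw [Fintype.card_fin] at h2
      rw [h1, eq_sub_iff_add_eq]
      exact_mod_cast h2
    rw [nsmul_eq_mul, nsmul_eq_mul, hc1, hc2]
    obtain ⟨m, hm⟩ : ∃ m, Aᶜ.card = m + 1 := by
      refine ⟨Aᶜ.card - 1, ?_⟩
      have : 0 < Aᶜ.card := Finset.card_pos.2
        (Finset.nonempty_iff_ne_empty.2 (by simpa using hA))
      omega
    have hH := collectorProd_succ_mul (N := N) hy m
    rw [hm, Nat.add_sub_cancel, hexp, Real.sinh_sub]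
    set u := collectorProd N (Real.exp (L * θ) * Real.sinh (L * θ)) (m + 1)
    set u' := collectorProd N (Real.exp (L * θ) * Real.sinh (L * θ)) m
    set M : ℝ := ((m + 1 : ℕ) : ℝ)
    have hE : Real.exp (L * θ) * (Real.cosh (L * θ) - Real.sinh (L * θ)) = 1 := by
      rw [Real.cosh_sub_sinh, ← Real.exp_add]; simp
    field_simp
    linear_combination (-Real.sinh θ) * hH - M * u * Real.sinh θ * hE
  · rw [tsum_spiderStep_leg_mul]
    have hv' : coverValue L θ (leg r j) A
        = coverValue L θ (atHeight (r + 1) j) (A ∪ cover L (atHeight (r + 1) j)) := by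
      change _ = coverValue L θ (leg r j) (A ∪ cover L (leg r j))
      rw [Finset.union_eq_left.2 hv]
    have e1 : (L * θ - (r : ℕ) * θ : ℝ) = (L * θ - (r + 1 : ℕ) * θ) + θ := by push_cast; ring
    have e2 : (L * θ - (r + 2 : ℕ) * θ : ℝ) = (L * θ - (r + 1 : ℕ) * θ) - θ := by push_cast; ring
    have e3 : ((r : ℕ) * θ : ℝ) = (r + 1 : ℕ) * θ - θ := by push_cast; ring
    have e4 : ((r + 2 : ℕ) * θ : ℝ) = (r + 1 : ℕ) * θ + θ := by push_cast; ring
    rw [hv']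
    by_cases hj : j ∈ A
    · rw [coverValue_of_mem hL _ hj, coverValue_of_mem hL _ hj, coverValue_of_mem hL _ hj,
        e1, e2, hexp, hexp']
      ring
    · rcases lt_trichotomy (r + 1) L with h | h | h
      · rw [coverValue_of_height_le hθ hL (by omega) hj, coverValue_of_height_le hθ hL (by omega) hj,
          coverValue_of_height_le hθ hL (by omega) hj, e1, e2, e3, e4]
        simp only [Real.sinh_add, Real.sinh_sub]
        ring
      -- At height exactly `L` the leg is covered, which `hv` records.
      · exact absurd (hv (by simp [cover, atHeight, ← h])) hj
      · rw [coverValue_of_le_height hL (by omega) hj, coverValue_of_le_height hL (by omega) hj,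
          coverValue_of_le_height hL (by omega) hj, e1, e2, hexp, hexp']
        ring

end

/-- The generating function of the cover time, in closed form. -/
theorem IsSpiderWalk.integral_coverWeight_cosh {N : ℕ} {Ω : Type*} [MeasurableSpace Ω]
    {P : Measure Ω} [IsProbabilityMeasure P] {S : ℕ → Ω → SpiderVertex N}
    (hS : IsSpiderWalk (fun _ : Fin N => 1 / (N : ℝ)) P S) (hN : 1 ≤ N) {L : ℕ} (hL : 1 ≤ L)
    {θ : ℝ} (hθ : 0 < θ) :
    Measurable (fun ω => coverWeight L (Real.cosh θ)⁻¹ fun k => S k ω) ∧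
    ∫ ω, coverWeight L (Real.cosh θ)⁻¹ (fun k => S k ω) ∂P
      = Real.exp (L * θ) * collectorProd N (Real.exp (L * θ) * Real.sinh (L * θ)) N := by
  have h0 : cover L (body : SpiderVertex N) = ∅ := by
    have := cover_atHeight hL 0 (⟨0, hN⟩ : Fin N)
    rwa [if_neg (by omega)] at this
  have hne : (∅ : Finset (Fin N)) ≠ Finset.univ := by
    have : Nonempty (Fin N) := ⟨⟨0, hN⟩⟩
    exact Finset.univ_nonempty.ne_empty.symm
  rw [← coverValue_body_empty, ← h0]
  refine hS.integral_coverWeight (inv_pos.2 (Real.cosh_pos θ))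
    (inv_lt_one_of_one_lt₀ (Real.one_lt_cosh.2 hθ.ne'))
    (le_add_of_nonneg_left (Real.exp_nonneg _)) (abs_coverValue_le hθ hL)
    (fun v hv => coverValue_univ hL hv) (fun v A hA hv => ?_) (h0 ▸ hne)
  rw [tsum_spiderStep_mul_coverValue hN hθ hL v hA hv, ← mul_assoc,
    inv_mul_cancel₀ (Real.cosh_pos θ).ne', one_mul]

/-! ### Asymptotics of the coupon collector product -/

/-- The bounds show that the solution `θ` is asymptotic to `√(2 * κ)` as `κ → 0`. -/
theorem exists_cosh_eq_exp {κ : ℝ} (hκ : 0 < κ) :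
    ∃ θ, 0 < θ ∧ Real.cosh θ = Real.exp κ ∧ 2 * κ ≤ θ ^ 2 ∧ θ ^ 2 ≤ 2 * (Real.exp κ - 1) := by
  have h1 : 1 < Real.exp κ := Real.one_lt_exp_iff.2 hκ
  have h2 := Real.cosh_arcosh h1.le
  have hθ : 0 < Real.arcosh (Real.exp κ) := Real.arcosh_pos h1
  refine ⟨Real.arcosh (Real.exp κ), hθ, h2, ?_, ?_⟩
  · have := Real.cosh_le_exp_half_sq (Real.arcosh (Real.exp κ))
    rw [h2, Real.exp_le_exp] at this
    linarith
  · set θ := Real.arcosh (Real.exp κ)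
    have h3 : Real.cosh θ = 1 + 2 * Real.sinh (θ / 2) ^ 2 := by
      rw [show θ = 2 * (θ / 2) by ring, Real.cosh_two_mul, Real.cosh_sq]
      ring_nf
    have h4 : θ / 2 ≤ Real.sinh (θ / 2) := Real.self_le_sinh_iff.2 (by positivity)
    have h5 := pow_le_pow_left₀ (by positivity) h4 2
    rw [← h2, h3]
    linarith

/-- The sum of `N y / i` over `1 ≤ i ≤ N` is `N y` times a harmonic number, hence asymptotic to
`N y log N`, and no single term matters. -/
theorem tendsto_collectorProd {y : ℕ → ℝ} (hy : ∀ᶠ N in atTop, 0 ≤ y N) {β : ℝ}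
    (h : Tendsto (fun N : ℕ => N * y N * Real.log N) atTop (𝓝 β)) :
    Tendsto (fun N => collectorProd N (y N) N) atTop (𝓝 (Real.exp (-β))) := by
  have hlog : Tendsto (fun N : ℕ => Real.log N) atTop atTop :=
    Real.tendsto_log_atTop.comp tendsto_natCast_atTop_atTop
  have hz : Tendsto (fun N : ℕ => N * y N) atTop (𝓝 0) := by
    refine (h.div_atTop hlog).congr' ?_
    filter_upwards [hlog.eventually_gt_atTop 0] with N hN
    field_simp
  have hharm : Tendsto (fun N : ℕ => N * y N * (harmonic N : ℝ)) atTop (𝓝 β) := by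
    refine tendsto_of_tendsto_of_tendsto_of_le_of_le' h
      (by simpa [mul_add] using hz.add h : Tendsto (fun N : ℕ => N * y N * (1 + Real.log N)) atTop
        (𝓝 β)) ?_ ?_
    · filter_upwards [hy, eventually_gt_atTop 0] with N hN hN0
      refine mul_le_mul_of_nonneg_left ?_ (by positivity)
      refine le_trans ?_ (log_add_one_le_harmonic N)
      exact Real.log_le_log (by positivity) (by push_cast; linarith)
    · filter_upwards [hy] with N hN
      exact mul_le_mul_of_nonneg_left (harmonic_le_one_add_log N) (by positivity)
  have hprod : Tendsto (fun N : ℕ => ∏ i ∈ Finset.range N, (1 + N / (i + 1) * y N)) atTop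
      (𝓝 (Real.exp β)) := by
    -- The lower bound comes from `log (1 + x) ≥ x - x ^ 2`, the upper one from `1 + x ≤ exp x`.
    have hlow : Tendsto (fun N : ℕ => Real.exp (N * y N * (harmonic N : ℝ)
        - N * y N * (N * y N * (harmonic N : ℝ)))) atTop (𝓝 (Real.exp β)) := by
      refine (Real.continuous_exp.tendsto _).comp ?_
      simpa using hharm.sub (hz.mul hharm)
    refine tendsto_of_tendsto_of_tendsto_of_le_of_le' hlow
      ((Real.continuous_exp.tendsto _).comp hharm) ?_ ?_
    · filter_upwards [hy] with N hN
      have hsum : N * y N * (harmonic N : ℝ) - N * y N * (N * y N * (harmonic N : ℝ))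
          = ∑ i ∈ Finset.range N, (N * y N * ((i : ℝ) + 1)⁻¹
            - N * y N * (N * y N * ((i : ℝ) + 1)⁻¹)) := by
        simp [harmonic, Finset.sum_sub_distrib, Finset.mul_sum]
      rw [hsum, Real.exp_sum]
      refine Finset.prod_le_prod (fun i _ => Real.exp_nonneg _) fun i _ => ?_
      set x : ℝ := N / (i + 1) * y N with hx
      have hx0 : 0 ≤ x := by positivity
      have hxe : N * y N * ((i : ℝ) + 1)⁻¹ = x := by rw [hx]; ring
      have hx2 : x * x ≤ N * y N * x := by
        refine mul_le_mul_of_nonneg_right ?_ hx0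
        rw [← hxe]
        exact mul_le_of_le_one_right (by positivity) (inv_le_one_of_one_le₀ (by
          have : (0 : ℝ) ≤ i := by positivity
          linarith))
      rw [hxe, ← Real.le_log_iff_exp_le (by positivity)]
      refine le_trans ?_ (Real.one_sub_inv_le_log_of_pos (by positivity))
      have h1 : 1 - (1 + x)⁻¹ - (x - x * x) = x ^ 3 / (1 + x) := by
        field_simp
        ring
      have h2 : 0 ≤ x ^ 3 / (1 + x) := by positivity
      linarith
    · filter_upwards [hy] with N hN
      have hsum : N * y N * (harmonic N : ℝ)
          = ∑ i ∈ Finset.range N, (N * y N * ((i : ℝ) + 1)⁻¹) := by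
        simp [harmonic, Finset.mul_sum]
      simp only [Function.comp]
      rw [hsum, Real.exp_sum]
      refine Finset.prod_le_prod (fun i _ => by positivity) fun i _ => ?_
      rw [add_comm, show N * y N * ((i : ℝ) + 1)⁻¹ = N / (i + 1) * y N by ring]
      exact Real.add_one_le_exp _
  rw [Real.exp_neg]
  refine (hprod.inv₀ (Real.exp_ne_zero β)).congr fun N => ?_
  rw [collectorProd, Finset.prod_inv_distrib]

theorem tendsto_exp_mul_collectorProd {a : ℕ → ℝ} (ha : ∀ᶠ N in atTop, 0 ≤ a N) {β : ℝ}
    (h : Tendsto (fun N : ℕ => a N * (N * Real.log N)) atTop (𝓝 β)) :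
    Tendsto (fun N => Real.exp (a N) * collectorProd N (Real.exp (a N) * Real.sinh (a N)) N) atTop
      (𝓝 (Real.exp (-β))) := by
  have hlog : Tendsto (fun N : ℕ => Real.log N) atTop atTop :=
    Real.tendsto_log_atTop.comp tendsto_natCast_atTop_atTop
  have hNlog : Tendsto (fun N : ℕ => (N : ℝ) * Real.log N) atTop atTop :=
    tendsto_natCast_atTop_atTop.atTop_mul_atTop₀ hlog
  have ha0 : Tendsto a atTop (𝓝 0) := by
    refine (h.div_atTop hNlog).congr' ?_
    filter_upwards [hNlog.eventually_gt_atTop 0] with N hN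
    exact mul_div_cancel_right₀ _ hN.ne'
  have hexp : Tendsto (fun N => Real.exp (a N)) atTop (𝓝 1) := by
    rw [← Real.exp_zero]
    exact (Real.continuous_exp.tendsto 0).comp ha0
  have hid : ∀ x : ℝ, Real.exp x * Real.sinh x = (Real.exp (2 * x) - 1) / 2 := fun x => by
    rw [Real.sinh_eq, mul_div_assoc', mul_sub, ← Real.exp_add, ← Real.exp_add]
    simp [two_mul]
  suffices hy : Tendsto (fun N : ℕ => N * (Real.exp (a N) * Real.sinh (a N)) * Real.log N) atTop
      (𝓝 β) by
    have h0 : ∀ᶠ N in atTop, 0 ≤ Real.exp (a N) * Real.sinh (a N) := by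
      filter_upwards [ha] with N hN
      exact mul_nonneg (Real.exp_nonneg _) (Real.sinh_nonneg_iff.2 hN)
    simpa using hexp.mul (tendsto_collectorProd h0 hy)
  have hup : Tendsto (fun N : ℕ => a N * (N * Real.log N) * (1 + 2 * a N)) atTop (𝓝 β) := by
    simpa using h.mul ((ha0.const_mul 2).const_add 1)
  refine tendsto_of_tendsto_of_tendsto_of_le_of_le' h hup ?_ ?_
  · filter_upwards [hNlog.eventually_gt_atTop 0] with N hN
    have h1 := Real.add_one_le_exp (2 * a N)
    have h2 : a N ≤ Real.exp (a N) * Real.sinh (a N) := by rw [hid]; linarith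
    have := mul_le_mul_of_nonneg_right h2 hN.le
    linarith
  · filter_upwards [hNlog.eventually_gt_atTop 0, ha, ha0.eventually_lt_const one_half_pos]
      with N hN hN0 hN1
    have h1 := (abs_le.1 (Real.abs_exp_sub_one_sub_id_le (x := 2 * a N) (by
      rw [abs_of_nonneg (by positivity)]; linarith))).2
    have h2 : Real.exp (a N) * Real.sinh (a N) ≤ a N * (1 + 2 * a N) := by rw [hid]; linarith
    have := mul_le_mul_of_nonneg_right h2 hN.le
    linarith

/-! ### Convergence of the Laplace transform of the cover time -/

theorem SpiderVertex.coverWeight_pow {N : ℕ} (L : ℕ) (s : ℝ) (x : ℕ → SpiderVertex N) {k : ℕ}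
    (hk : k ≠ 0) : coverWeight L s x ^ k = coverWeight L (s ^ k) x := by
  unfold coverWeight
  split_ifs
  · rw [← pow_mul, ← pow_mul, mul_comm]
  · exact zero_pow hk

theorem SpiderVertex.coverWeight_mem_unitInterval {N : ℕ} (L : ℕ) {s : ℝ} (hs0 : 0 ≤ s)
    (hs1 : s ≤ 1) (x : ℕ → SpiderVertex N) : coverWeight L s x ∈ unitInterval := by
  unfold coverWeight
  split_ifs
  · exact ⟨by positivity, pow_le_one₀ hs0 hs1⟩
  · simp

theorem SpiderVertex.exp_neg_one_le_coverWeight_iff {N : ℕ} (L : ℕ) {A : ℝ} (hA : 0 < A)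
    (x : ℕ → SpiderVertex N) :
    Real.exp (-1) ≤ coverWeight L (Real.exp (-(1 / A))) x
      ↔ coveredLegs L x ⌊A⌋₊ = Finset.univ := by
  unfold coverWeight
  split_ifs with h
  · rw [coveredLegs_eq_univ_iff h, Nat.le_floor_iff hA.le, ← Real.exp_nat_mul, Real.exp_le_exp,
      mul_neg, neg_le_neg_iff, mul_one_div, div_le_one hA]
  · push Not at h
    simp [h, Real.exp_pos]

/-- The Laplace transform of the cover time at `κ`, which is its generating function at
`1 / cosh θ = exp (-κ)`. -/
theorem IsSpiderWalk.exists_integral_coverWeight_exp {N : ℕ} {Ω : Type*} [MeasurableSpace Ω]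
    {P : Measure Ω} [IsProbabilityMeasure P] {S : ℕ → Ω → SpiderVertex N}
    (hS : IsSpiderWalk (fun _ : Fin N => 1 / (N : ℝ)) P S) (hN : 1 ≤ N) {L : ℕ} (hL : 1 ≤ L)
    {κ : ℝ} (hκ : 0 < κ) :
    Measurable (fun ω => coverWeight L (Real.exp (-κ)) fun k => S k ω) ∧
    ∃ θ, 0 < θ ∧ 2 * κ ≤ θ ^ 2 ∧ θ ^ 2 ≤ 2 * (Real.exp κ - 1) ∧
      ∫ ω, coverWeight L (Real.exp (-κ)) (fun k => S k ω) ∂P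
        = Real.exp (L * θ) * collectorProd N (Real.exp (L * θ) * Real.sinh (L * θ)) N := by
  obtain ⟨θ, hθ, hc, h1, h2⟩ := exists_cosh_eq_exp hκ
  have := hS.integral_coverWeight_cosh hN hL hθ
  rw [hc, ← Real.exp_neg] at this
  exact ⟨this.1, θ, hθ, h1, h2, this.2⟩

/-- The Laplace transform of `T / (c L N log N) ^ 2` converges to that of `1 / (c Z) ^ 2`. -/
theorem tendsto_integral_coverWeight {c : ℝ} (hc : 0 < c) {L : ℕ → ℕ}
    (hL : ∀ᶠ N : ℕ in atTop, 1 ≤ L N)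
    {Ω : ℕ → Type*} [∀ N, MeasurableSpace (Ω N)] {P : ∀ N, Measure (Ω N)}
    [∀ N, IsProbabilityMeasure (P N)] {S : ∀ N, ℕ → Ω N → SpiderVertex N}
    (hS : ∀ N, 1 ≤ N → IsSpiderWalk (fun _ : Fin N => 1 / (N : ℝ)) (P N) (S N)) {k : ℝ}
    (hk : 0 < k) :
    Tendsto (fun N : ℕ => ∫ ω, coverWeight (L N)
      (Real.exp (-(k / (c * L N * N * Real.log N) ^ 2))) (fun n => S N n ω) ∂P N) atTop
      (𝓝 (Real.exp (-(√(2 * k) / c)))) := by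
  have hlog : Tendsto (fun N : ℕ => Real.log N) atTop atTop :=
    Real.tendsto_log_atTop.comp tendsto_natCast_atTop_atTop
  have hNlog : Tendsto (fun N : ℕ => (N : ℝ) * Real.log N) atTop atTop :=
    tendsto_natCast_atTop_atTop.atTop_mul_atTop₀ hlog
  set R : ℕ → ℝ := fun N => c * L N * N * Real.log N with hR
  have hRtop : Tendsto R atTop atTop := by
    refine tendsto_atTop_mono' _ ?_ (hNlog.const_mul_atTop hc)
    filter_upwards [hL, hNlog.eventually_gt_atTop 0] with N h1 h2
    have h3 : (1 : ℝ) ≤ L N := by exact_mod_cast h1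
    have := le_mul_of_one_le_right (mul_pos hc h2).le h3
    simp only [hR]
    linarith
  -- `θ N` solves `cosh (θ N) = exp (k / R N ^ 2)`; the bounds give `θ N * R N → √(2 * k)`.
  have hex : ∀ N, ∃ θ, (1 ≤ L N ∧ 1 ≤ N ∧ 0 < R N) → 0 < θ ∧ 2 * (k / R N ^ 2) ≤ θ ^ 2 ∧
      θ ^ 2 ≤ 2 * (Real.exp (k / R N ^ 2) - 1) ∧
      ∫ ω, coverWeight (L N) (Real.exp (-(k / R N ^ 2))) (fun n => S N n ω) ∂P N
        = Real.exp (L N * θ)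
          * collectorProd N (Real.exp (L N * θ) * Real.sinh (L N * θ)) N := by
    intro N
    by_cases hcond : 1 ≤ L N ∧ 1 ≤ N ∧ 0 < R N
    · obtain ⟨h1, h2, h3⟩ := hcond
      obtain ⟨-, θ, hθ⟩ := (hS N h2).exists_integral_coverWeight_exp h2 h1
        (κ := k / R N ^ 2) (by positivity)
      exact ⟨θ, fun _ => hθ⟩
    · exact ⟨0, fun h => absurd h hcond⟩
  choose θ hθ using hex
  have hev : ∀ᶠ N in atTop, 1 ≤ L N ∧ 1 ≤ N ∧ 0 < R N := by
    filter_upwards [hL, eventually_ge_atTop 1, hRtop.eventually_gt_atTop 0] with N h1 h2 h3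
    exact ⟨h1, h2, h3⟩
  have hsq : Tendsto (fun N => (θ N * R N) ^ 2) atTop (𝓝 (2 * k)) := by
    have hup : Tendsto (fun N => 2 * (k + k ^ 2 / R N ^ 2)) atTop (𝓝 (2 * k)) := by
      have : Tendsto (fun N => k ^ 2 / R N ^ 2) atTop (𝓝 0) :=
        tendsto_const_nhds.div_atTop ((tendsto_pow_atTop two_ne_zero).comp hRtop)
      simpa using (this.const_add k).const_mul 2
    have hsmall : ∀ᶠ N in atTop, k / R N ^ 2 ≤ 1 := by
      have : Tendsto (fun N => k / R N ^ 2) atTop (𝓝 0) :=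
        tendsto_const_nhds.div_atTop ((tendsto_pow_atTop two_ne_zero).comp hRtop)
      exact this.eventually_le_const one_pos
    refine tendsto_of_tendsto_of_tendsto_of_le_of_le' tendsto_const_nhds hup ?_ ?_
    · filter_upwards [hev] with N hN
      obtain ⟨-, h1, -⟩ := hθ N hN
      have hR0 := hN.2.2
      rw [mul_pow, ← div_le_iff₀ (by positivity)]
      linarith [mul_div_assoc 2 k (R N ^ 2)]
    · filter_upwards [hev, hsmall] with N hN hN1
      obtain ⟨-, -, h1, -⟩ := hθ N hN
      have hR0 := hN.2.2
      have h2 := (abs_le.1 (Real.abs_exp_sub_one_sub_id_le (x := k / R N ^ 2) (by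
        rwa [abs_of_nonneg (by positivity)]))).2
      have h3 : θ N ^ 2 ≤ 2 * (k / R N ^ 2 + (k / R N ^ 2) ^ 2) := by linarith
      rw [mul_pow]
      refine (mul_le_mul_of_nonneg_right h3 (sq_nonneg (R N))).trans (le_of_eq ?_)
      field_simp
  have hlin : Tendsto (fun N => θ N * R N) atTop (𝓝 (√(2 * k))) := by
    refine ((Real.continuous_sqrt.tendsto _).comp hsq).congr' ?_
    filter_upwards [hev] with N hN
    exact Real.sqrt_sq (mul_pos (hθ N hN).1 hN.2.2).le
  have ha : Tendsto (fun N => (L N * θ N) * (N * Real.log N)) atTop (𝓝 (√(2 * k) / c)) := by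
    refine (hlin.div_const c).congr fun N => ?_
    simp only [hR]
    field_simp
  refine (tendsto_exp_mul_collectorProd ?_ ha).congr' ?_
  · filter_upwards [hev] with N hN
    exact mul_nonneg (Nat.cast_nonneg _) (hθ N hN).1.le
  · filter_upwards [hev] with N hN
    exact (hθ N hN).2.2.2.symm

theorem exp_neg_one_le_exp_neg_iff {c z : ℝ} (hc : 0 < c) (hz : z ≠ 0) :
    Real.exp (-1) ≤ Real.exp (-(1 / (c ^ 2 * z ^ 2))) ↔ 1 / c ≤ |z| := by
  have hz' : 0 < |z| := abs_pos.2 hz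
  rw [Real.exp_le_exp, neg_le_neg_iff, ← sq_abs z, ← mul_pow, div_le_one (by positivity),
    one_le_sq_iff₀ (by positivity), div_le_iff₀' hc]

/-! ### The limit theorem -/

theorem theorem5p2
    (c : ℝ) (hc : 0 < c)
    (L : ℕ → ℕ)
    (hL : ∀ᶠ N : ℕ in atTop, 1 ≤ L N ∧ (L N : ℝ) ≤ (N : ℝ) / Real.log N)
    (Ω : ℕ → Type*) [∀ N, MeasurableSpace (Ω N)]
    (P : ∀ N, Measure (Ω N)) [∀ N, IsProbabilityMeasure (P N)]
    (S : ∀ N, ℕ → Ω N → SpiderVertex N)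
    (hS : ∀ N, 1 ≤ N → IsSpiderWalk (fun _ : Fin N => 1 / (N : ℝ)) (P N) (S N)) :
    Tendsto
      (fun N : ℕ =>
        (P N).real (spiderAllLegsEvent (S N) ⌊(c * L N * N * Real.log N) ^ 2⌋₊ (L N)))
      atTop
      (𝓝 ((gaussianReal 0 1).real {z : ℝ | 1 / c < |z|})) := by
  have hL1 : ∀ᶠ N : ℕ in atTop, 1 ≤ L N := hL.mono fun N h => h.1
  -- Only `N ≥ N₀ ≥ 2` matter: there the scale `A N` is positive and `L N ≥ 1`.
  obtain ⟨N₀, hN₀⟩ := eventually_atTop.1 (hL1.and (eventually_ge_atTop 2))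
  set A : ℕ → ℝ := fun N => (c * L N * N * Real.log N) ^ 2 with hA
  have hApos : ∀ n, 0 < A (n + N₀) := by
    intro n
    obtain ⟨h1, h2⟩ := hN₀ (n + N₀) (by omega)
    have h3 : (0 : ℝ) < L (n + N₀) := by exact_mod_cast h1
    have h4 : (1 : ℝ) < ((n + N₀ : ℕ) : ℝ) := by exact_mod_cast h2
    have h5 := Real.log_pos h4
    have h6 : (0 : ℝ) < ((n + N₀ : ℕ) : ℝ) := by linarith
    simp only [hA]
    positivity
  have hs : ∀ N, Real.exp (-(1 / A N)) ≤ 1 := fun N => Real.exp_le_one_iff.2 (by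
    have : 0 ≤ 1 / A N := div_nonneg zero_le_one (sq_nonneg _)
    linarith)
  -- `X = exp (-T / A)` and `Y = exp (-1 / (c Z) ^ 2)`: the covering event is `X ≥ exp (-1)`.
  let X : ∀ N, Ω N → unitInterval := fun N ω =>
    ⟨coverWeight (L N) (Real.exp (-(1 / A N))) fun k => S N k ω,
      coverWeight_mem_unitInterval _ (Real.exp_nonneg _) (hs N) _⟩
  have hX : ∀ n, Measurable (X (n + N₀)) := fun n => by
    obtain ⟨h1, h2⟩ := hN₀ (n + N₀) (by omega)
    exact ((hS (n + N₀) (by omega)).exists_integral_coverWeight_exp (by omega) h1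
      (one_div_pos.2 (hApos n))).1.subtype_mk
  let Y : ℝ → unitInterval := fun z => ⟨Real.exp (-(1 / (c ^ 2 * z ^ 2))), Real.exp_nonneg _,
    Real.exp_le_one_iff.2 (by
      have : 0 ≤ 1 / (c ^ 2 * z ^ 2) := by positivity
      linarith)⟩
  have hY : Measurable Y := Measurable.subtype_mk (by fun_prop)
  let t : unitInterval := ⟨Real.exp (-1), Real.exp_nonneg _, Real.exp_le_one_iff.2 (by norm_num)⟩
  have hmom : ∀ k : ℕ, Tendsto (fun n => ∫ ω, (X (n + N₀) ω : ℝ) ^ k ∂P (n + N₀)) atTop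
      (𝓝 (∫ z, (Y z : ℝ) ^ k ∂gaussianReal 0 1)) := by
    intro k
    rcases Nat.eq_zero_or_pos k with rfl | hk
    · simp
    have hk' : (0 : ℝ) < k := by exact_mod_cast hk
    have hYk : ∫ z, (Y z : ℝ) ^ k ∂gaussianReal 0 1 = Real.exp (-(√(2 * k) / c)) := by
      rw [← integral_exp_neg_div_sq_gaussianReal (b := √(2 * k) / c) (by positivity)]
      refine integral_congr_ae (Eventually.of_forall fun z => ?_)
      simp only [Y]
      rw [← Real.exp_nat_mul, div_pow, Real.sq_sqrt (by positivity)]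
      congr 1
      rw [mul_neg, mul_one_div, div_div, mul_left_comm, mul_div_mul_left _ _ two_ne_zero]
    rw [hYk]
    refine ((tendsto_add_atTop_iff_nat N₀).2
      (tendsto_integral_coverWeight hc hL1 hS hk')).congr fun n => ?_
    refine integral_congr_ae (Eventually.of_forall fun ω => ?_)
    simp only [X]
    rw [coverWeight_pow _ _ _ hk.ne', ← Real.exp_nat_mul, mul_neg, mul_one_div]
  -- Null sets to be discarded: `0`, where `1 / z ^ 2` has a junk value, and the boundary
  -- `|z| = 1 / c` of the limiting event.
  have hne : ∀ᵐ z ∂gaussianReal 0 1, z ≠ 0 ∧ |z| ≠ 1 / c := by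
    have := nullSingletonClass_gaussianReal (μ := 0) (v := 1) one_ne_zero
    have h1 : ∀ᵐ z ∂gaussianReal 0 1, z ∉ ({0, 1 / c, -(1 / c)} : Set ℝ) :=
      measure_eq_zero_iff_ae_notMem.1 (Set.Finite.measure_zero (Set.toFinite _) _)
    filter_upwards [h1] with z hz
    simp only [Set.mem_insert_iff, Set.mem_singleton_iff, not_or] at hz
    refine ⟨hz.1, fun h => ?_⟩
    rcases (abs_eq (by positivity)).1 h with h | h
    exacts [hz.2.1 h, hz.2.2 h]
  have ht : gaussianReal 0 1 {z | Y z = t} = 0 := by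
    rw [measure_eq_zero_iff_ae_notMem]
    filter_upwards [hne] with z ⟨hz0, hz⟩ hzt
    have h1 : Real.exp (-(1 / (c ^ 2 * z ^ 2))) = Real.exp (-1) := congrArg Subtype.val hzt
    have h2 := neg_injective (Real.exp_injective h1)
    rw [← sq_abs z, ← mul_pow, div_eq_one_iff_eq (by positivity)] at h2
    have h3 : c * |z| = 1 := 
      (pow_eq_one_iff_of_nonneg (by positivity) two_ne_zero).1 h2.symm
    exact hz (by rw [eq_div_iff hc.ne', mul_comm, h3])
  have hmain := tendsto_measureReal_le_of_moments hX hY hmom t ht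
  rw [← tendsto_add_atTop_iff_nat N₀]
  have hlim : (gaussianReal 0 1).real {z | t ≤ Y z}
      = (gaussianReal 0 1).real {z : ℝ | 1 / c < |z|} := by
    refine measureReal_congr ?_
    filter_upwards [hne] with z ⟨hz0, hz⟩
    exact propext ((exp_neg_one_le_exp_neg_iff hc hz0).trans
      ⟨fun h => lt_of_le_of_ne h (Ne.symm hz), le_of_lt⟩)
  rw [← hlim]
  refine hmain.congr fun n => ?_
  rw [spiderAllLegsEvent_eq]
  congr 1
  ext ω
  exact exp_neg_one_le_coverWeight_iff _ (hApos n) _
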